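/- A bipartite graph $G=([m]\cup[n]',E)$ has vertex set the disjoint union of $[m]=\{1,\dots,m\}$ and $[n]'=\{1',\dots,n'\}$, with $m,n\ge 0$, and every edge joins $[m]$ to $[n]'$; it is balanced if $m=n$. Isomorphisms map $[m]$ to $[m]$ and $[n]'$ to $[n]'$, and induced subgraphs are regarded as bipartite graphs of this form, up to isomorphism. $G$ is chordal bipartite if it has no chordless cycle of length other than four. A perfect matching of $G$ is given by a bijection $\pi:[m]\to[n]'$ with all $(i,\pi_i)\in E$. The switch chain on the set $\Omega$ of perfect matchings of $G$ moves from $\pi$ as follows: choose rows $i,j$ independently and uniformly at random; if $i\ne j$ and $(i,\pi_j),(j,\pi_i)\in E$, replace the edges $(i,\pi_i),(j,\pi_j)$ of the matching by $(i,\pi_j),(j,\pi_i)$; otherwise stay at $\pi$. Its transition graph has vertex set $\Omega$, and two distinct matchings are adjacent if the chain moves from one to the other with positive probability. The chain is called ergodic on $G$ if any two elements of $\Omega$ are joined by a path in the transition graph ($\Omega=\emptyset$ is allowed), and $G$ is called hereditarily ergodic if the chain is ergodic on every induced subgraph $G[U]$. The largest hereditary class of bipartite graphs on which the switch chain is ergodic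 is the class of balanced chordal bipartite graphs. Precisely, with respect to inclusion: 1. the class of balanced chordal bipartite graphs is the largest class of balanced bipartite graphs that contains all balanced induced subgraphs of its members and on all of whose members the switch chain is ergodic; 2. it is also the largest class of balanced bipartite graphs all of whose members are hereditarily ergodic; 3. if unbalanced graphs (which have no perfect matching) are admitted, the class of all chordal bipartite graphs is the largest class of bipartite graphs that contains all induced subgraphs of its members and on all of whose members the switch chain is ergodic. Moreover, if $G=([n]\cup[n]',E)$ is chordal bipartite, then the transition graph of the switch chain on $G$ has diameter at most $n$ (the diameter being $\infty$ for a disconnected graph, and $0$ for the empty graph); and if also $n\ge 1$, then the transition matrix of the chain is primitive, that is, the chain is irreducible and aperiodic. -/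

import Mathlib

/-- A bipartite graph with row vertices `α` and column vertices `β`: a simple graph on the
disjoint union `α ⊕ β` in which both sides are independent. -/
structure BipGraph (α β : Type) where
  graph : SimpleGraph (α ⊕ β)
  not_adj_inl : ∀ a a' : α, ¬ graph.Adj (Sum.inl a) (Sum.inl a')
  not_adj_inr : ∀ b b' : β, ¬ graph.Adj (Sum.inr b) (Sum.inr b')

namespace BipGraph

variable {α β : Type}

/-- `(a, b')` is an edge of `G`. -/
def Edge (G : BipGraph α β) (a : α) (b : β) : Prop :=
  G.graph.Adj (Sum.inl a) (Sum.inr b)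

/-- The induced subgraph `G[U]` for a set `U` of vertices (rows and columns). -/
def induce (G : BipGraph α β) (U : Set (α ⊕ β)) :
    BipGraph {a : α // Sum.inl a ∈ U} {b : β // Sum.inr b ∈ U} where
  graph := G.graph.comap (Sum.map Subtype.val Subtype.val)
  not_adj_inl a a' := G.not_adj_inl a a'
  not_adj_inr b b' := G.not_adj_inr b b'

/-- Isomorphism of bipartite graphs (rows go to rows and columns to columns). -/
def Isomorphic {α' β' : Type} (G : BipGraph α β) (H : BipGraph α' β') : Prop :=
  ∃ (σ : α ≃ α') (τ : β ≃ β'), ∀ a b, G.Edge a b ↔ H.Edge (σ a) (τ b)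

/-- A graph is chordal bipartite if every chordless cycle has length four. -/
def ChordalBipartite (G : BipGraph α β) : Prop :=
  ∀ (v : α ⊕ β) (c : G.graph.Walk v v), c.IsCycle → c.IsChordless → c.length = 4

/-- Perfect matchings of `G`, the states of the switch chain: the bijections `π` from rows to
columns such that every `(i, π i)` is an edge. -/
@[ext]
structure PerfectMatching (G : BipGraph α β) where
  toEquiv : α ≃ β
  edge : ∀ i, G.Edge i (toEquiv i)

open scoped Classical in
/-- One step of the switch chain from `π`, when the rows `i` and `j` have been chosen. The new
matching contains `(i, π j)` and `(j, π i)` if `i ≠ j` and both are edges; otherwise it is `π`. -/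
noncomputable def switch (G : BipGraph α β) (π : G.PerfectMatching) (i j : α) :
    G.PerfectMatching :=
  if h : i ≠ j ∧ G.Edge i (π.toEquiv j) ∧ G.Edge j (π.toEquiv i) then
    { toEquiv := (Equiv.swap i j).trans π.toEquiv
      edge := by
        intro k
        by_cases hi : k = i
        · subst hi; simpa using h.2.1
        · by_cases hj : k = j
          · subst hj; simpa using h.2.2
          · simpa [Equiv.swap_apply_of_ne_of_ne hi hj] using π.edge k }
  else π

open scoped Classical in
theorem switch_switch (G : BipGraph α β) (π : G.PerfectMatching) (i j : α) :
    G.switch (G.switch π i j) i j = π := by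
  by_cases h : i ≠ j ∧ G.Edge i (π.toEquiv j) ∧ G.Edge j (π.toEquiv i)
  · have h1 : (G.switch π i j).toEquiv = (Equiv.swap i j).trans π.toEquiv := by
      rw [switch, dif_pos h]
    have h2 : i ≠ j ∧ G.Edge i ((G.switch π i j).toEquiv j) ∧
        G.Edge j ((G.switch π i j).toEquiv i) := by
      rw [h1]
      simpa using ⟨h.1, π.edge i, π.edge j⟩
    apply PerfectMatching.ext
    rw [switch, dif_pos h2]
    ext k
    simp [h1]
  · have h1 : G.switch π i j = π := by rw [switch, dif_neg h]
    rw [h1, h1]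

/-- The transition matrix of the switch chain: `i` and `j` are chosen independently and uniformly
among the rows. -/
noncomputable def transitionMatrix (G : BipGraph α β) :
    Matrix G.PerfectMatching G.PerfectMatching ℝ :=
  fun π τ => (Nat.card {p : α × α // G.switch π p.1 p.2 = τ} : ℝ) / (Nat.card α : ℝ) ^ 2

theorem transitionMatrix_symm (G : BipGraph α β) (π τ : G.PerfectMatching) :
    G.transitionMatrix π τ = G.transitionMatrix τ π := by
  have h : ∀ p : α × α, G.switch π p.1 p.2 = τ ↔ G.switch τ p.1 p.2 = π := fun p =>
    ⟨fun h => by rw [← h, switch_switch], fun h => by rw [← h, switch_switch]⟩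
  simp only [transitionMatrix, h]

/-- The transition graph of the switch chain: distinct perfect matchings are adjacent if the chain
moves from one to the other with positive probability. -/
def transitionGraph (G : BipGraph α β) : SimpleGraph G.PerfectMatching where
  Adj π τ := π ≠ τ ∧ 0 < G.transitionMatrix π τ
  symm := ⟨fun π τ h => ⟨h.1.symm, G.transitionMatrix_symm π τ ▸ h.2⟩⟩
  loopless := ⟨fun _ h => h.1 rfl⟩

/-- The switch chain is ergodic on `G` if the set of perfect matchings, which may be empty, is
connected by switches. (Aperiodicity is automatic because of the choices `i = j`.) -/
def IsErgodic (G : BipGraph α β) : Prop :=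
  G.transitionGraph.Preconnected

/-- Every induced subgraph is ergodic. -/
def HereditarilyErgodic (G : BipGraph α β) : Prop :=
  ∀ U : Set (α ⊕ β), (G.induce U).IsErgodic

noncomputable instance [Finite α] [Finite β] (G : BipGraph α β) : Fintype G.PerfectMatching :=
  haveI : Finite G.PerfectMatching :=
    Finite.of_injective PerfectMatching.toEquiv fun _ _ h => PerfectMatching.ext h
  Fintype.ofFinite _

noncomputable instance (G : BipGraph α β) : DecidableEq G.PerfectMatching :=
  Classical.decEq _

end BipGraph

/-- A class of bipartite graphs `([m] ∪ [n]', E)`; `C m n` is the set of its members with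
`m` rows and `n` columns. The order on classes is inclusion. -/
abbrev GraphClass : Type := ∀ m n : ℕ, Set (BipGraph (Fin m) (Fin n))

namespace GraphClass

/-- Every member has as many rows as columns. -/
def Balanced (C : GraphClass) : Prop :=
  ∀ m n, ∀ G ∈ C m n, m = n

/-- All induced subgraphs of members, up to isomorphism, are members. -/
def Hereditary (C : GraphClass) : Prop :=
  ∀ m n, ∀ G ∈ C m n, ∀ U : Set (Fin m ⊕ Fin n),
    ∀ (k l : ℕ) (H : BipGraph (Fin k) (Fin l)), H.Isomorphic (G.induce U) → H ∈ C k l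

/-- All balanced induced subgraphs of members, up to isomorphism, are members. -/
def BalancedHereditary (C : GraphClass) : Prop :=
  ∀ m n, ∀ G ∈ C m n, ∀ U : Set (Fin m ⊕ Fin n),
    ∀ (k : ℕ) (H : BipGraph (Fin k) (Fin k)), H.Isomorphic (G.induce U) → H ∈ C k k

/-- The switch chain is ergodic on every member. -/
def Ergodic (C : GraphClass) : Prop :=
  ∀ m n, ∀ G ∈ C m n, G.IsErgodic

/-- Every member is hereditarily ergodic. -/
def HereditarilyErgodic (C : GraphClass) : Prop :=
  ∀ m n, ∀ G ∈ C m n, G.HereditarilyErgodic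

/-- The class of chordal bipartite graphs. -/
def chordalBipartite : GraphClass :=
  fun _ _ => {G | G.ChordalBipartite}

/-- The class of balanced chordal bipartite graphs. -/
def balancedChordalBipartite : GraphClass :=
  fun m n => {G | m = n ∧ G.ChordalBipartite}

end GraphClass

/-! Maximality: a graph that is not chordal bipartite contains an induced cycle with `k ≥ 3` rows (a
crown). Such a cycle has two perfect matchings, yet no switch is possible, since a switch needs a
4-cycle. Hence one balanced induced subgraph is not ergodic
(`exists_isomorphic_induce_not_isErgodic`), which settles all three maximality claims.

Diameter: for perfect matchings `π`, `σ`, the permutation `π⁻¹σ` of the rows splits into disjoint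
cycles, each an alternating cycle of `G`. One with at least three rows has a chord, which cuts it
into two shorter alternating cycles that can be switched in succession. By induction a cycle with
`k` rows costs at most `k - 1` switches (`edist_le_of_formPerm`), and summing over the cycles gives
at most `n`. Ergodicity follows from this bound, and primitivity too, because the choices `i = j`
allow the chain to wait. -/

namespace SimpleGraph

variable {V : Type*} {G : SimpleGraph V}

/-! ### Chordless cycles as embedded cycle graphs -/

theorem cycleGraph_adj_iff_val {n : ℕ} (hn : 2 ≤ n) {u v : Fin n} :
    (cycleGraph n).Adj u v ↔ u.val + 1 = v.val ∨ v.val + 1 = u.val ∨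
      (u.val = 0 ∧ v.val + 1 = n) ∨ (v.val = 0 ∧ u.val + 1 = n) := by
  rw [cycleGraph_adj']
  have hu := u.isLt
  have hv := v.isLt
  rcases lt_trichotomy u v with h | h | h
  · rw [Fin.coe_sub_iff_lt.mpr h, Fin.coe_sub_iff_le.mpr h.le]
    have h' : u.val < v.val := h
    omega
  · subst h
    rw [Fin.coe_sub_iff_le.mpr le_rfl]
    omega
  · rw [Fin.coe_sub_iff_lt.mpr h, Fin.coe_sub_iff_le.mpr h.le]
    have h' : v.val < u.val := h
    omega

theorem cycleGraph.mk_add_one_mem_edges_cycle {n : ℕ} (x : Fin (n + 3)) :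
    s(x + 1, x) ∈ (cycleGraph.cycle n).edges := by
  have hx := x.isLt
  have h : (n + 2 - x.val) < (cycleGraph.cycle n).length := by
    rw [cycleGraph.length_cycle]; omega
  -- `cycleGraph.cycle` runs through the vertices in decreasing order, so it passes from `x + 1` to
  -- `x` at position `n + 2 - x`.
  have h1 : (cycleGraph.cycle n).getVert (n + 2 - x.val) = x + 1 := by
    rw [cycleGraph.getVert_cycle (by omega)]
    ext
    rw [Fin.val_add]
    simp only [Fin.val_one]
    congr 1
    omega
  have h2 : (cycleGraph.cycle n).getVert (n + 2 - x.val + 1) = x := by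
    rw [cycleGraph.getVert_cycle (by omega)]
    ext
    simp only
    rw [show n + 3 - (n + 2 - x.val + 1) = x.val by omega, Nat.mod_eq_of_lt hx]
  exact (Walk.mk_mem_edges_iff_exists _).mpr ⟨_, h, by rw [h1, h2]⟩

theorem cycleGraph.isChordless_cycle {n : ℕ} : (cycleGraph.cycle n).IsChordless := by
  rw [Walk.isChordless_iff_forall_mem_edges]
  intro x y _ _ h
  rcases cycleGraph_adj.mp h with h | h
  · rw [sub_eq_iff_eq_add'] at h
    rw [h]
    exact mk_add_one_mem_edges_cycle y
  · rw [sub_eq_iff_eq_add'] at h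
    rw [h, Sym2.eq_swap]
    exact mk_add_one_mem_edges_cycle x

/-- A chordless cycle in a simple graph is an induced copy of a cycle graph. -/
theorem exists_chordless_cycle_of_embedding {n : ℕ} (φ : cycleGraph (n + 3) ↪g G) :
    ∃ (v : V) (c : G.Walk v v), c.IsCycle ∧ c.IsChordless ∧ c.length = n + 3 := by
  refine ⟨_, (cycleGraph.cycle n).map φ.toHom,
    (Walk.isCycle_map_iff_of_injective φ.injective).mpr cycleGraph.isCycle_cycle, ?_, by simp⟩
  rw [Walk.isChordless_iff_forall_mem_edges]
  intro u v hu hv h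
  rw [Walk.support_map, List.mem_map] at hu hv
  obtain ⟨x, hx, rfl⟩ := hu
  obtain ⟨y, hy, rfl⟩ := hv
  rw [Walk.edges_map, List.mem_map]
  exact ⟨s(x, y), cycleGraph.isChordless_cycle.mem_edges hx hy (φ.map_adj_iff.mp h), rfl⟩

theorem Walk.IsCycle.nonempty_cycleGraph_embedding {v : V} {c : G.Walk v v} (hc : c.IsCycle)
    (hch : c.IsChordless) : Nonempty (cycleGraph c.length ↪g G) := by
  have h3 := hc.three_le_length
  have hclose : c.getVert c.length = c.getVert 0 := by simp
  refine ⟨⟨⟨fun i => c.getVert i, ?_⟩, ?_⟩⟩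
  · intro i j h
    have hi := i.isLt
    have hj := j.isLt
    exact Fin.ext (hc.getVert_injOn' (Set.mem_ofPred.mpr (by omega))
      (Set.mem_ofPred.mpr (by omega)) h)
  · intro i j
    have hi := i.isLt
    have hj := j.isLt
    change G.Adj (c.getVert i) (c.getVert j) ↔ _
    rw [cycleGraph_adj_iff_val (by omega)]
    have hend : ∀ x y : ℕ, x = 0 → y + 1 = c.length → G.Adj (c.getVert x) (c.getVert y) := by
      rintro x y rfl h
      have := (c.adj_getVert_succ (i := y) (by omega)).symm
      rwa [h, hclose] at this
    constructor
    · intro h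
      have := hch.mem_edges (c.getVert_mem_support _) (c.getVert_mem_support _) h
      obtain ⟨m, hm, h⟩ := (c.mk_mem_edges_iff_exists).mp this
      have inj : ∀ {a b : ℕ}, a < c.length → b < c.length → c.getVert a = c.getVert b → a = b :=
        fun ha hb h => hc.getVert_injOn' (Set.mem_ofPred.mpr (by omega))
          (Set.mem_ofPred.mpr (by omega)) h
      -- The upper end of the edge may be the closing vertex, which has index `c.length` as well as
      -- index `0`.
      have inj' : ∀ {a : ℕ}, a < c.length → c.getVert (m + 1) = c.getVert a →
          a = m + 1 ∨ (a = 0 ∧ m + 1 = c.length) := by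
        intro a ha h
        rcases Nat.lt_or_ge (m + 1) c.length with h' | h'
        · exact Or.inl (inj h' ha h).symm
        · have h'' : m + 1 = c.length := by omega
          rw [h'', hclose] at h
          exact Or.inr ⟨(inj (by omega) ha h).symm, h''⟩
      rcases Sym2.eq_iff.mp h with ⟨h1, h2⟩ | ⟨h1, h2⟩
      · have := inj hm hi h1
        have := inj' hj h2
        omega
      · have := inj hm hj h1
        have := inj' hi h2
        omega
    · rintro (h | h | h | h)
      · rw [← h]; exact c.adj_getVert_succ hi
      · rw [← h]; exact (c.adj_getVert_succ hj).symm
      · exact hend _ _ h.1 h.2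
      · exact (hend _ _ h.1 h.2).symm

/-- The rotation of the cycle graph. -/
def cycleGraph.rotate (n : ℕ) : cycleGraph (n + 2) ≃g cycleGraph (n + 2) where
  toEquiv := Equiv.addRight 1
  map_rel_iff' := by simp [cycleGraph_adj]

end SimpleGraph

/-! ### Long induced cycles as crowns -/

namespace BipGraph

open SimpleGraph

variable {α β : Type}

/-- The rows `e i` and the columns `f j` induce a cycle in which row `e i` is adjacent to the
columns `f i` and `f (i - 1)`, indices being read modulo `k`. -/
def IsCrown (G : BipGraph α β) {k : ℕ} (e : Fin k → α) (f : Fin k → β) : Prop :=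
  ∀ i j : Fin k, G.Edge (e i) (f j) ↔
    i.val = j.val ∨ i.val = j.val + 1 ∨ (i.val = 0 ∧ j.val + 1 = k)

theorem ChordalBipartite.not_isCrown {G : BipGraph α β} (hG : G.ChordalBipartite) {k : ℕ}
    (hk : 3 ≤ k) {e : Fin k → α} {f : Fin k → β} (he : e.Injective) (hf : f.Injective) :
    ¬ G.IsCrown e f := by
  intro h
  obtain ⟨m, rfl⟩ : ∃ m, k = m + 3 := ⟨k - 3, by omega⟩
  -- Rows and columns are interleaved: `e i` sits at position `2i` of the cycle and `f i` at
  -- position `2i + 1`.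
  let φ : Fin (2 * m + 3 + 3) → α ⊕ β := fun x =>
    if x.val % 2 = 0 then Sum.inl (e ⟨x.val / 2, by omega⟩)
    else Sum.inr (f ⟨x.val / 2, by omega⟩)
  have hφ0 : ∀ x, x.val % 2 = 0 → φ x = Sum.inl (e ⟨x.val / 2, by omega⟩) := fun x hx => if_pos hx
  have hφ1 : ∀ x, ¬ x.val % 2 = 0 → φ x = Sum.inr (f ⟨x.val / 2, by omega⟩) :=
    fun x hx => if_neg hx
  have hinj : φ.Injective := by
    intro x y hxy
    by_cases hx : x.val % 2 = 0 <;> by_cases hy : y.val % 2 = 0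
    · rw [hφ0 x hx, hφ0 y hy] at hxy
      have := Fin.mk.inj_iff.mp (he (Sum.inl_injective hxy))
      exact Fin.ext (by omega)
    · rw [hφ0 x hx, hφ1 y hy] at hxy
      cases hxy
    · rw [hφ1 x hx, hφ0 y hy] at hxy
      cases hxy
    · rw [hφ1 x hx, hφ1 y hy] at hxy
      have := Fin.mk.inj_iff.mp (hf (Sum.inr_injective hxy))
      exact Fin.ext (by omega)
  have hadj : ∀ x y, G.graph.Adj (φ x) (φ y) ↔ (cycleGraph (2 * m + 3 + 3)).Adj x y := by
    intro x y
    rw [cycleGraph_adj_iff_val (by omega)]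
    have hx' := x.isLt
    have hy' := y.isLt
    by_cases hx : x.val % 2 = 0 <;> by_cases hy : y.val % 2 = 0
    · rw [hφ0 x hx, hφ0 y hy, iff_false_left (G.not_adj_inl _ _)]
      omega
    · rw [hφ0 x hx, hφ1 y hy]
      refine (h _ _).trans ?_
      simp only
      omega
    · rw [hφ1 x hx, hφ0 y hy, G.graph.adj_comm]
      refine (h _ _).trans ?_
      simp only
      omega
    · rw [hφ1 x hx, hφ1 y hy, iff_false_left (G.not_adj_inr _ _)]
      omega
  obtain ⟨v, c, hc, hch, hl⟩ := exists_chordless_cycle_of_embedding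
    (⟨⟨φ, hinj⟩, hadj _ _⟩ : cycleGraph (2 * m + 3 + 3) ↪g G.graph)
  have := hG v c hc hch
  omega

theorem isLeft_eq_not_of_adj (G : BipGraph α β) {x y : α ⊕ β} (h : G.graph.Adj x y) :
    y.isLeft = !x.isLeft := by
  rcases x with a | b <;> rcases y with a' | b'
  · exact (G.not_adj_inl _ _ h).elim
  · rfl
  · rfl
  · exact (G.not_adj_inr _ _ h).elim

/-- Sides alternate along the cycle, so the even positions are rows and the odd ones columns; the
closing edge forces the length to be even. -/
theorem exists_isCrown_of_embedding (G : BipGraph α β) {n : ℕ}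
    (φ : cycleGraph (n + 3) ↪g G.graph) (h0 : (φ 0).isLeft) :
    ∃ (k : ℕ) (e : Fin k → α) (f : Fin k → β), n + 3 = 2 * k ∧ e.Injective ∧ f.Injective ∧
      G.IsCrown e f := by
  have hpar : ∀ (x : ℕ) (hx : x < n + 3), (φ ⟨x, hx⟩).isLeft = decide (x % 2 = 0) := by
    intro x
    induction x with
    | zero => intro hx; simpa using h0
    | succ x ih =>
      intro hx
      have hadj : G.graph.Adj (φ ⟨x, by omega⟩) (φ ⟨x + 1, hx⟩) :=
        φ.map_adj_iff.mpr ((cycleGraph_adj_iff_val (by omega)).mpr (Or.inl rfl))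
      rw [G.isLeft_eq_not_of_adj hadj, ih]
      rcases Nat.mod_two_eq_zero_or_one x with h | h
      · simp [h, Nat.add_mod]
      · simp [h, Nat.add_mod]
  have heven : (n + 3) % 2 = 0 := by
    have hadj : G.graph.Adj (φ 0) (φ ⟨n + 2, by omega⟩) :=
      φ.map_adj_iff.mpr ((cycleGraph_adj_iff_val (by omega)).mpr
        (Or.inr (Or.inr (Or.inl ⟨rfl, rfl⟩))))
    have := G.isLeft_eq_not_of_adj hadj
    rw [hpar, h0] at this
    have : ¬ (n + 2) % 2 = 0 := by simpa using this
    omega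
  obtain ⟨k, hk⟩ : ∃ k, n + 3 = 2 * k := ⟨(n + 3) / 2, by omega⟩
  have he : ∀ i : Fin k, ∃ a, φ ⟨2 * i.val, by omega⟩ = Sum.inl a := fun i =>
    Sum.isLeft_iff.mp (by rw [hpar]; simp)
  have hf : ∀ i : Fin k, ∃ b, φ ⟨2 * i.val + 1, by omega⟩ = Sum.inr b := fun i =>
    Sum.isRight_iff.mp (by rw [← Sum.not_isLeft, hpar]; simp)
  choose e he using he
  choose f hf using hf
  refine ⟨k, e, f, hk, ?_, ?_, ?_⟩
  · intro i j hij
    have := Fin.mk.inj_iff.mp (φ.injective ((he i).trans ((congrArg _ hij).trans (he j).symm)))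
    exact Fin.ext (by omega)
  · intro i j hij
    have := Fin.mk.inj_iff.mp (φ.injective ((hf i).trans ((congrArg _ hij).trans (hf j).symm)))
    exact Fin.ext (by omega)
  · intro i j
    rw [Edge, ← he, ← hf, φ.map_adj_iff, cycleGraph_adj_iff_val (by omega)]
    simp only
    omega

/-- A bipartite graph that is not chordal bipartite has an induced cycle of length at least six. -/
theorem exists_isCrown_of_not_chordalBipartite {G : BipGraph α β} (hG : ¬ G.ChordalBipartite) :
    ∃ (k : ℕ) (e : Fin k → α) (f : Fin k → β), 3 ≤ k ∧ e.Injective ∧ f.Injective ∧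
      G.IsCrown e f := by
  rw [ChordalBipartite] at hG
  push Not at hG
  obtain ⟨v, c, hc, hch, h4⟩ := hG
  obtain ⟨φ⟩ := hc.nonempty_cycleGraph_embedding hch
  obtain ⟨n, hn⟩ : ∃ n, c.length = n + 3 := ⟨c.length - 3, by have := hc.three_le_length; omega⟩
  rw [hn] at φ
  -- If the cycle starts at a column, rotating it by one position makes it start at a row.
  have key : ∃ φ : cycleGraph (n + 3) ↪g G.graph, (φ 0).isLeft := by
    by_cases h : (φ 0).isLeft
    · exact ⟨φ, h⟩
    · refine ⟨φ.comp (cycleGraph.rotate (n + 1)).toEmbedding, ?_⟩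
      have hadj : G.graph.Adj (φ 0) (φ (0 + 1)) := φ.map_adj_iff.mpr (by simp [cycleGraph_adj])
      have := G.isLeft_eq_not_of_adj hadj
      rw [Bool.not_eq_true] at h
      rw [h] at this
      exact this
  obtain ⟨φ, h0⟩ := key
  obtain ⟨k, e, f, hk, h⟩ := G.exists_isCrown_of_embedding φ h0
  exact ⟨k, e, f, by omega, h⟩

/-! ### Crowns are not ergodic -/

theorem exists_switch_eq_of_adj {G : BipGraph α β} {π τ : G.PerfectMatching}
    (h : G.transitionGraph.Adj π τ) : ∃ i j, G.switch π i j = τ := by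
  by_contra! hne
  have : IsEmpty {p : α × α // G.switch π p.1 p.2 = τ} := ⟨fun p => hne _ _ p.2⟩
  have h2 := h.2
  simp [transitionMatrix] at h2

theorem transitionMatrix_switch_pos [Finite α] (G : BipGraph α β) (π : G.PerfectMatching)
    (i j : α) : 0 < G.transitionMatrix π (G.switch π i j) := by
  have : Nonempty α := ⟨i⟩
  have : Nonempty {p : α × α // G.switch π p.1 p.2 = G.switch π i j} := ⟨⟨(i, j), rfl⟩⟩
  have h1 : 0 < Nat.card {p : α × α // G.switch π p.1 p.2 = G.switch π i j} := Nat.card_pos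
  have h2 : 0 < Nat.card α := Nat.card_pos
  unfold transitionMatrix
  positivity

/-- A cycle of length at least six has two perfect matchings but no switch. -/
theorem IsCrown.not_isErgodic {G : BipGraph α β} {k : ℕ} (hk : 3 ≤ k) {e : Fin k ≃ α}
    {f : Fin k ≃ β} (h : G.IsCrown e f) : ¬ G.IsErgodic := by
  intro herg
  have hno : ∀ π τ, ¬ G.transitionGraph.Adj π τ := by
    intro π τ hadj
    obtain ⟨a, b, hsw⟩ := exists_switch_eq_of_adj hadj
    by_cases hc : a ≠ b ∧ G.Edge a (π.toEquiv b) ∧ G.Edge b (π.toEquiv a)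
    · obtain ⟨i, rfl⟩ := e.surjective a
      obtain ⟨j, rfl⟩ := e.surjective b
      obtain ⟨hne, h1, h2⟩ := hc
      have h3 := π.edge (e i)
      have h4 := π.edge (e j)
      have hpq : π.toEquiv (e i) ≠ π.toEquiv (e j) := fun h => hne (π.toEquiv.injective h)
      generalize π.toEquiv (e i) = c at *
      generalize π.toEquiv (e j) = d at *
      obtain ⟨p, rfl⟩ := f.surjective c
      obtain ⟨q, rfl⟩ := f.surjective d
      rw [h] at h1 h2 h3 h4
      have hij : i.val ≠ j.val := fun h => hne (congrArg e (Fin.ext h))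
      have hpq : p.val ≠ q.val := fun h => hpq (congrArg f (Fin.ext h))
      -- Rows `i ≠ j` would both be adjacent to columns `p ≠ q`, a 4-cycle, which is impossible for
      -- `k ≥ 3`.
      omega
    · rw [switch, dif_neg hc] at hsw
      exact hadj.1 hsw
  have heq : ∀ π τ : G.PerfectMatching, π = τ := by
    intro π τ
    obtain ⟨w⟩ := herg π τ
    cases w with
    | nil => rfl
    | cons h _ => exact (hno _ _ h).elim
  obtain ⟨m, rfl⟩ : ∃ m, k = m + 3 := ⟨k - 3, by omega⟩
  let π : G.PerfectMatching := ⟨e.symm.trans f, fun a => by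
    obtain ⟨i, rfl⟩ := e.surjective a
    simpa using (h i i).mpr (Or.inl rfl)⟩
  -- The other matching of the cycle sends row `i` to column `i - 1`; the two differ at row `1`.
  let τ : G.PerfectMatching := ⟨e.symm.trans ((finRotate (m + 3)).symm.trans f), fun a => by
    obtain ⟨i, rfl⟩ := e.surjective a
    obtain ⟨j, rfl⟩ := (finRotate (m + 3)).surjective i
    simp only [Equiv.trans_apply, Equiv.symm_apply_apply]
    rw [h, coe_finRotate]
    split_ifs with hj
    · subst hj
      simp
    · omega⟩
  have := congrArg (fun σ => f.symm (σ.toEquiv (e 1))) (heq π τ)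
  have h01 : (finRotate (m + 3)).symm 1 = 0 := by
    rw [Equiv.symm_apply_eq]
    simp
  simp [π, τ, h01] at this

theorem IsCrown.exists_induce {G : BipGraph α β} {k : ℕ} {e : Fin k → α} {f : Fin k → β}
    (he : e.Injective) (hf : f.Injective) (h : G.IsCrown e f) :
    ∃ (U : Set (α ⊕ β)) (e' : Fin k ≃ {a : α // Sum.inl a ∈ U})
      (f' : Fin k ≃ {b : β // Sum.inr b ∈ U}), (G.induce U).IsCrown e' f' := by
  refine ⟨Set.range (Sum.map e f),
    Equiv.ofBijective (fun i => ⟨e i, Sum.inl i, rfl⟩) ⟨fun i j hij => ?_, ?_⟩,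
    Equiv.ofBijective (fun i => ⟨f i, Sum.inr i, rfl⟩) ⟨fun i j hij => ?_, ?_⟩, fun i j => h i j⟩
  · exact he (congrArg Subtype.val hij)
  · rintro ⟨a, i | i, hi⟩
    · exact ⟨i, Subtype.ext (Sum.inl_injective hi)⟩
    · cases hi
  · exact hf (congrArg Subtype.val hij)
  · rintro ⟨a, i | i, hi⟩
    · cases hi
    · exact ⟨i, Subtype.ext (Sum.inr_injective hi)⟩

/-- The copy `H` on `Fin k` serves the classes closed under induced subgraphs; `G.induce U` itself
serves hereditary ergodicity. -/
theorem exists_isomorphic_induce_not_isErgodic {G : BipGraph α β} (hG : ¬ G.ChordalBipartite) :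
    ∃ (U : Set (α ⊕ β)) (k : ℕ) (H : BipGraph (Fin k) (Fin k)),
      H.Isomorphic (G.induce U) ∧ ¬ H.IsErgodic ∧ ¬ (G.induce U).IsErgodic := by
  obtain ⟨k, e, f, hk, he, hf, h⟩ := exists_isCrown_of_not_chordalBipartite hG
  obtain ⟨U, e', f', h'⟩ := h.exists_induce he hf
  let H : BipGraph (Fin k) (Fin k) :=
    ⟨(G.induce U).graph.comap (Sum.map e' f'), fun _ _ => (G.induce U).not_adj_inl _ _,
      fun _ _ => (G.induce U).not_adj_inr _ _⟩
  have hH : H.IsCrown (Equiv.refl (Fin k)) (Equiv.refl (Fin k)) := h'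
  exact ⟨U, k, H, ⟨e', f', fun _ _ => Iff.rfl⟩, hH.not_isErgodic hk, h'.not_isErgodic hk⟩

/-! ### Chordal bipartiteness passes to induced subgraphs -/

theorem ChordalBipartite.of_embedding {α' β' : Type} {G : BipGraph α β} {H : BipGraph α' β'}
    (hG : G.ChordalBipartite) (φ : H.graph ↪g G.graph) : H.ChordalBipartite := by
  intro v c hc hch
  have h := hG _ (c.map φ.toHom) ((Walk.isCycle_map_iff_of_injective φ.injective).mpr hc) (by
    rw [Walk.isChordless_iff_forall_mem_edges]
    intro u v hu hv h
    rw [Walk.support_map, List.mem_map] at hu hv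
    obtain ⟨x, hx, rfl⟩ := hu
    obtain ⟨y, hy, rfl⟩ := hv
    rw [Walk.edges_map, List.mem_map]
    exact ⟨s(x, y), hch.mem_edges hx hy (φ.map_adj_iff.mp h), rfl⟩)
  rwa [Walk.length_map] at h

theorem ChordalBipartite.induce {G : BipGraph α β} (hG : G.ChordalBipartite) (U : Set (α ⊕ β)) :
    (G.induce U).ChordalBipartite :=
  hG.of_embedding (SimpleGraph.Embedding.comap
    ⟨Sum.map Subtype.val Subtype.val, Subtype.val_injective.sumMap Subtype.val_injective⟩ _)

theorem ChordalBipartite.of_isomorphic {α' β' : Type} {G : BipGraph α β} {H : BipGraph α' β'}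
    (hG : G.ChordalBipartite) (h : H.Isomorphic G) : H.ChordalBipartite := by
  obtain ⟨σ, τ, h⟩ := h
  refine hG.of_embedding ⟨(Equiv.sumCongr σ τ).toEmbedding, ?_⟩
  rintro (a | b) (a' | b')
  · exact iff_of_false (G.not_adj_inl _ _) (H.not_adj_inl _ _)
  · exact (h a b').symm
  · rw [SimpleGraph.adj_comm, H.graph.adj_comm]
    exact (h a' b).symm
  · exact iff_of_false (G.not_adj_inr _ _) (H.not_adj_inr _ _)

end BipGraph

/-! ### Splitting a cyclic permutation -/

theorem List.formPerm_append_cons {α : Type*} [DecidableEq α] (x : α) (m : List α) :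
    ∀ l : List α, (l ++ x :: m).formPerm = (l ++ [x]).formPerm * (x :: m).formPerm
  | [] => by simp
  | [a] => by simp [List.formPerm_cons_cons]
  | a :: b :: l => by
    have := List.formPerm_append_cons x m (b :: l)
    simp only [List.cons_append, List.formPerm_cons_cons, mul_assoc] at this ⊢
    rw [this]

/-- This is the algebraic form of cutting an alternating cycle along a chord at `x`: the last entry
of `l` goes to `x` and thence to the head of `m`. -/
theorem List.formPerm_cons_append {α : Type*} [DecidableEq α] {x : α} {l m : List α}
    (h : (x :: (l ++ m)).Nodup) :
    (x :: (l ++ m)).formPerm = (x :: m).formPerm * (x :: l).formPerm := by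
  have h1 : (x :: (l ++ m)) ~r (m ++ x :: l) := ⟨l.length + 1, by
    rw [← List.cons_append]; exact List.rotate_append_length_eq (x :: l) m⟩
  have h2 : (x :: m) ~r (m ++ [x]) := ⟨1, by simp⟩
  rw [List.formPerm_eq_of_isRotated h h1, List.formPerm_append_cons,
    List.formPerm_eq_of_isRotated _ h2]
  simp only [List.nodup_cons, List.mem_append, List.nodup_append] at h ⊢
  tauto

/-! ### The diameter bound -/

namespace BipGraph

open SimpleGraph Equiv

variable {α β : Type}

theorem edist_switch_le_one [Finite α] (G : BipGraph α β) (π : G.PerfectMatching) (i j : α) :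
    G.transitionGraph.edist π (G.switch π i j) ≤ 1 := by
  rw [edist_le_one_iff_adj_or_eq]
  by_cases h : π = G.switch π i j
  · exact Or.inr h
  · exact Or.inl ⟨h, G.transitionMatrix_switch_pos π i j⟩

/-- An alternating cycle of length at least six has a chord. -/
theorem ChordalBipartite.exists_chord [DecidableEq α] {G : BipGraph α β}
    (hG : G.ChordalBipartite) (π : G.PerfectMatching) {l : List α} (hl : l.Nodup)
    (h3 : 3 ≤ l.length) (h : ∀ i, G.Edge i (π.toEquiv (l.formPerm i))) :
    ∃ i ∈ l, ∃ j ∈ l, j ≠ i ∧ j ≠ l.formPerm i ∧ G.Edge i (π.toEquiv j) := by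
  by_contra! hno
  let e : Fin l.length → α := fun i => l[i]
  -- With this indexing row `l[i]` meets column `i` through the successor edge and column `i - 1`
  -- through its `π`-edge; without a chord this is a crown.
  let f : Fin l.length → β := fun j => π.toEquiv (l.formPerm l[j])
  have he : e.Injective := fun i j hij => Fin.ext ((hl.getElem_inj_iff).mp hij)
  have hf : f.Injective := fun i j hij => he (l.formPerm.injective (π.toEquiv.injective hij))
  refine hG.not_isCrown h3 he hf fun i j => ?_
  have hi := i.isLt
  have hj := j.isLt
  have key : l[i] = l.formPerm l[j] ↔ i.val = j.val + 1 ∨ (i.val = 0 ∧ j.val + 1 = l.length) := by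
    simp only [Fin.getElem_fin]
    rw [List.formPerm_apply_getElem _ hl, hl.getElem_inj_iff]
    rcases Nat.lt_or_ge (j.val + 1) l.length with h | h
    · rw [Nat.mod_eq_of_lt h]
      omega
    · rw [show j.val + 1 = l.length by omega, Nat.mod_self]
      omega
  rw [← key]
  constructor
  · intro hE
    by_contra! hc
    refine hno l[i] (List.getElem_mem _) (l.formPerm l[j])
      (List.formPerm_apply_mem_of_mem (List.getElem_mem _)) hc.2.symm (fun h => ?_) hE
    exact hc.1 (congrArg Fin.val (he (l.formPerm.injective h))).symm
  · rintro (hij | hij)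
    · have : i = j := Fin.ext hij
      subst this
      exact h _
    · change G.Edge l[i] (π.toEquiv (l.formPerm l[j]))
      rw [← hij]
      exact π.edge _

/-- Two perfect matchings that differ in one alternating cycle with `k` rows are at distance
at most `k - 1`. -/
theorem ChordalBipartite.edist_le_of_formPerm [Finite α] [DecidableEq α] {G : BipGraph α β}
    (hG : G.ChordalBipartite) (k : ℕ) : ∀ (l : List α), l.Nodup → l.length ≤ k + 1 →
    ∀ π σ : G.PerfectMatching, σ.toEquiv = l.formPerm.trans π.toEquiv →
      G.transitionGraph.edist π σ ≤ k := by
  induction k using Nat.strong_induction_on with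
  | _ k ih =>
  intro l hl hk π σ hσ
  by_cases h1 : l.length ≤ 1
  · have : σ = π := by
      apply PerfectMatching.ext
      rw [hσ, (List.formPerm_eq_one_iff _ hl).mpr h1]
      rfl
    rw [this, SimpleGraph.edist_self]
    exact zero_le
  by_cases h2 : l.length = 2
  · obtain ⟨a, b, rfl⟩ := List.length_eq_two.mp h2
    have hab : a ≠ b := by simpa using hl
    have ha := σ.edge a
    have hb := σ.edge b
    rw [hσ] at ha hb
    simp only [List.formPerm_pair, Equiv.trans_apply, swap_apply_left, swap_apply_right] at ha hb
    have : σ = G.switch π a b := by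
      apply PerfectMatching.ext
      rw [switch, dif_pos ⟨hab, ha, hb⟩, hσ, List.formPerm_pair]
      congr!
    rw [this]
    refine (G.edist_switch_le_one π a b).trans ?_
    simp only [List.length_cons, List.length_nil] at hk
    exact_mod_cast (by omega : 1 ≤ k)
  have hedge : ∀ i, G.Edge i (π.toEquiv (l.formPerm i)) := fun i => by
    have := σ.edge i
    rwa [hσ] at this
  obtain ⟨i, hi, j, hj, hji, hjf, hE⟩ := hG.exists_chord π hl (by omega) hedge
  obtain ⟨s, t, rfl⟩ := List.append_of_mem hi
  have hrot : (s ++ i :: t) ~r (i :: (t ++ s)) := ⟨s.length, by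
    rw [List.rotate_append_length_eq, List.cons_append]⟩
  rw [List.formPerm_eq_of_isRotated hl hrot] at hσ hedge hjf
  rw [hrot.mem_iff] at hj
  rw [hrot.perm.length_eq] at hk h1
  rw [hrot.nodup_iff] at hl
  generalize t ++ s = r at *
  rcases r with _ | ⟨c, r⟩
  · simp at h1
  have hj : j ∈ r := by
    have hc : (i :: c :: r).formPerm i = c := List.formPerm_apply_head i c r hl
    rw [hc] at hjf
    simpa [hji, hjf] using hj
  obtain ⟨A, B, rfl⟩ := List.append_of_mem hj
  rw [← List.cons_append] at hl hσ hedge hk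
  have hform := List.formPerm_cons_append hl
  have hlen : A.length + B.length + 2 ≤ k := by
    simp only [List.length_cons, List.length_append] at hk
    omega
  have hlA : (i :: c :: A).Nodup := hl.sublist (by simp)
  have hlB : (i :: j :: B).Nodup := hl.sublist (by simp)
  -- The intermediate matching uses the chord at row `i`, agrees with `σ` on `j :: B`, and with `π`
  -- elsewhere.
  have hρ : ∀ x, G.Edge x (π.toEquiv ((i :: j :: B).formPerm x)) := by
    intro x
    by_cases hxi : x = i
    · subst hxi
      rwa [List.formPerm_apply_head _ _ _ hlB]
    by_cases hxB : x ∈ j :: B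
    · have hx : x ∉ i :: c :: A := by
        intro hx
        have hx : x ∈ c :: A := by simpa [hxi] using hx
        exact (List.disjoint_of_nodup_append (List.nodup_cons.mp hl).2) hx hxB
      have := hedge x
      rwa [hform, Perm.mul_apply, List.formPerm_apply_of_notMem hx] at this
    · rw [List.formPerm_apply_of_notMem (by simpa [hxi] using hxB)]
      exact π.edge x
  let ρ : G.PerfectMatching := ⟨(i :: j :: B).formPerm.trans π.toEquiv, hρ⟩
  have d1 := ih (B.length + 1) (by omega) _ hlB (by simp) π ρ rfl
  have d2 := ih (A.length + 1) (by omega) _ hlA (by simp) ρ σ (by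
    rw [hσ, hform]
    rfl)
  refine SimpleGraph.edist_triangle.trans ((add_le_add d1 d2).trans ?_)
  exact_mod_cast (by omega : B.length + 1 + (A.length + 1) ≤ k)

/-- Disjoint cycles can be processed one after another, and support sizes add up. The saving of one
switch per cycle is given away. -/
theorem ChordalBipartite.edist_le_card_support [Fintype α] [DecidableEq α] {G : BipGraph α β}
    (hG : G.ChordalBipartite) (τ : Perm α) : ∀ π σ : G.PerfectMatching,
    σ.toEquiv = τ.trans π.toEquiv → G.transitionGraph.edist π σ ≤ τ.support.card := by
  induction τ using Perm.cycle_induction_on with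
  | base_one =>
    intro π σ h
    have : σ = π := PerfectMatching.ext h
    simp [this]
  | base_cycles τ hτ =>
    intro π σ h
    obtain ⟨x, hx, -⟩ := id hτ
    have hform : (τ.toList x).formPerm = τ := by
      rw [Perm.formPerm_toList, hτ.cycleOf_eq hx]
    refine hG.edist_le_of_formPerm _ (τ.toList x) (Perm.nodup_toList _ _) ?_ π σ (by rw [hform, h])
    rw [Perm.length_toList, hτ.cycleOf_eq hx]
    omega
  | induction_disjoint τ₁ τ₂ hd _ h₁ h₂ =>
    intro π σ h
    have hρ : ∀ x, G.Edge x (π.toEquiv (τ₁ x)) := by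
      intro x
      rcases hd x with hx | hx
      · rw [hx]
        exact π.edge x
      · have := σ.edge x
        rwa [h, Equiv.trans_apply, Perm.mul_apply, hx] at this
    let ρ : G.PerfectMatching := ⟨τ₁.trans π.toEquiv, hρ⟩
    have d1 := h₁ π ρ rfl
    have d2 := h₂ ρ σ h
    rw [hd.card_support_mul, Nat.cast_add]
    exact SimpleGraph.edist_triangle.trans (add_le_add d1 d2)

theorem ChordalBipartite.ediam_transitionGraph_le [Finite α] {G : BipGraph α β}
    (hG : G.ChordalBipartite) : G.transitionGraph.ediam ≤ Nat.card α := by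
  classical
  have := Fintype.ofFinite α
  refine ediam_le_of_edist_le fun π σ => ?_
  refine (hG.edist_le_card_support (σ.toEquiv.trans π.toEquiv.symm) π σ
    (by ext; simp)).trans ?_
  rw [Nat.card_eq_fintype_card]
  exact_mod_cast Finset.card_le_univ _

theorem ChordalBipartite.isErgodic [Finite α] {G : BipGraph α β} (hG : G.ChordalBipartite) :
    G.IsErgodic :=
  preconnected_of_ediam_ne_top (hG.ediam_transitionGraph_le.trans_lt (ENat.natCast_lt_top _)).ne

/-! ### Primitivity -/

theorem transitionMatrix_nonneg (G : BipGraph α β) (π τ : G.PerfectMatching) :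
    0 ≤ G.transitionMatrix π τ := by
  unfold transitionMatrix
  positivity

theorem transitionMatrix_self_pos [Finite α] [Nonempty α] (G : BipGraph α β)
    (π : G.PerfectMatching) : 0 < G.transitionMatrix π π := by
  have i : α := Classical.arbitrary α
  have h : G.switch π i i = π := by
    rw [switch, dif_neg fun h => h.1 rfl]
  simpa [h] using G.transitionMatrix_switch_pos π i i

/-- A walk that is too short is padded by waiting at its end, so the diameter bound provides one
exponent for all pairs. -/
theorem transitionMatrix_pow_pos [Finite α] [Finite β] [Nonempty α] (G : BipGraph α β) (m : ℕ) :
    ∀ {π σ : G.PerfectMatching} (w : G.transitionGraph.Walk π σ), w.length ≤ m →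
      0 < (G.transitionMatrix ^ m) π σ := by
  have step : ∀ {m : ℕ} {π ρ σ : G.PerfectMatching}, 0 < G.transitionMatrix π ρ →
      0 < (G.transitionMatrix ^ m) ρ σ → 0 < (G.transitionMatrix ^ (m + 1)) π σ := by
    intro m π ρ σ h1 h2
    rw [pow_succ', Matrix.mul_apply]
    exact Finset.sum_pos' (fun τ _ => mul_nonneg (G.transitionMatrix_nonneg _ _)
      (Matrix.pow_apply_nonneg G.transitionMatrix_nonneg m τ σ))
      ⟨ρ, Finset.mem_univ _, mul_pos h1 h2⟩
  induction m with
  | zero =>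
    intro π σ w hw
    cases w with
    | nil => simp
    | cons _ _ => simp at hw
  | succ m ih =>
    intro π σ w hw
    cases w with
    | nil => exact step (G.transitionMatrix_self_pos π) (ih Walk.nil (by simp))
    | cons h p =>
      rw [Walk.length_cons] at hw
      exact step h.2 (ih p (by omega))

theorem ChordalBipartite.isPrimitive_transitionMatrix [Finite α] [Finite β] [Nonempty α]
    {G : BipGraph α β} (hG : G.ChordalBipartite) : G.transitionMatrix.IsPrimitive := by
  refine ⟨G.transitionMatrix_nonneg, Nat.card α, Nat.card_pos, fun π σ => ?_⟩
  obtain ⟨w, hw⟩ := (hG.isErgodic π σ).exists_walk_length_eq_edist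
  refine G.transitionMatrix_pow_pos _ w ?_
  have := (edist_le_ediam (u := π) (v := σ)).trans hG.ediam_transitionGraph_le
  rw [← hw] at this
  exact_mod_cast this

end BipGraph

theorem mainTheorem2 :
    IsGreatest {C : GraphClass | C.Balanced ∧ C.BalancedHereditary ∧ C.Ergodic}
      GraphClass.balancedChordalBipartite ∧
    IsGreatest {C : GraphClass | C.Balanced ∧ C.HereditarilyErgodic}
      GraphClass.balancedChordalBipartite ∧
    IsGreatest {C : GraphClass | C.Hereditary ∧ C.Ergodic} GraphClass.chordalBipartite ∧
    (∀ (n : ℕ) (G : BipGraph (Fin n) (Fin n)), G.ChordalBipartite →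
      G.transitionGraph.ediam ≤ (n : ℕ∞)) ∧
    (∀ (n : ℕ) (G : BipGraph (Fin n) (Fin n)), 1 ≤ n → G.ChordalBipartite →
      G.transitionMatrix.IsPrimitive) := by
  refine ⟨⟨⟨fun m n G h => h.1, fun m n G h U k H hH => ⟨rfl, (h.2.induce U).of_isomorphic hH⟩,
    fun m n G h => h.2.isErgodic⟩, ?_⟩, ⟨⟨fun m n G h => h.1, fun m n G h U =>
    (h.2.induce U).isErgodic⟩, ?_⟩, ⟨⟨fun m n G h U k l H hH =>
    (h.induce U).of_isomorphic hH, fun m n G h => h.isErgodic⟩, ?_⟩, ?_, ?_⟩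
  · rintro C ⟨hbal, hher, herg⟩ m n G hG
    refine ⟨hbal m n G hG, ?_⟩
    by_contra hnot
    obtain ⟨U, k, H, hH, hne, -⟩ := BipGraph.exists_isomorphic_induce_not_isErgodic hnot
    exact hne (herg k k H (hher m n G hG U k H hH))
  · rintro C ⟨hbal, herg⟩ m n G hG
    refine ⟨hbal m n G hG, ?_⟩
    by_contra hnot
    obtain ⟨U, -, -, -, -, hne⟩ := BipGraph.exists_isomorphic_induce_not_isErgodic hnot
    exact hne (herg m n G hG U)
  · rintro C ⟨hher, herg⟩ m n G hG
    by_contra hnot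
    obtain ⟨U, k, H, hH, hne, -⟩ := BipGraph.exists_isomorphic_induce_not_isErgodic hnot
    exact hne (herg k k H (hher m n G hG U k k H hH))
  · intro n G hG
    simpa using hG.ediam_transitionGraph_le
  · intro n G hn hG
    have : Nonempty (Fin n) := ⟨⟨0, hn⟩⟩
    exact hG.isPrimitive_transitionMatrix
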